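/- Let $0<p\le 1$ and $X\in\mathbb{R}^{m\times n}$, and write $\|X\|_{S_p}^p=\sum_{i=1}^{\min(m,n)}\sigma_i(X)^p$, where $\sigma_i(X)$ are the singular values of $X$. For $U\in\mathbb{R}^{m\times d}$ and $V\in\mathbb{R}^{n\times d}$ let $u_i$ and $v_i$ denote the columns of $U$ and $V$, and $\|\cdot\|_2$ the Euclidean norm. Then $$\|X\|_{S_p}^p=\min_{d\ge 1}\ \min_{\substack{U\in\mathbb{R}^{m\times d},\,V\in\mathbb{R}^{n\times d}\\ UV^T=X}}\ \sum_{i=1}^d\|u_i\|_2^p\|v_i\|_2^p=\min_{d\ge 1}\ \min_{\substack{U\in\mathbb{R}^{m\times d},\,V\in\mathbb{R}^{n\times d}\\ UV^T=X}}\ \frac1{2^p}\sum_{i=1}^d\left(\|u_i\|_2^2+\|v_i\|_2^2\right)^p .$$ Moreover, for every fixed $d\ge\operatorname{rank}(X)$ each of the two inner minima is attained and equals $\|X\|_{S_p}^p$. Finally, if $X=U_X\Sigma V_X^T$ is any singular value decomposition, where $U_X\in\mathbb{R}^{m\times d}$ and $V_X\in\mathbb{R}^{n\times d}$ have orthonormal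 columns and $\Sigma\in\mathbb{R}^{d\times d}$ is diagonal with nonnegative entries, then both minima are attained at $U=U_X\Sigma^{1/2}$, $V=V_X\Sigma^{1/2}$. -/

import Mathlib

noncomputable section

/-- The Schatten-`p` quasi-norm raised to the power `p`: the sum of the `p`-th powers of the
`min m n` singular values of `X`, the latter being those of `X` as a linear map between
Euclidean spaces (zero-indexed, in descending order, with multiplicity). -/
def schattenPow {m n : ℕ} (p : ℝ) (X : Matrix (Fin m) (Fin n) ℝ) : ℝ :=
  ∑ i ∈ Finset.range (min m n), (Matrix.toEuclideanLin X).singularValues i ^ p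

/-- The Euclidean norm of the `i`-th column of `U`. -/
def colNorm {m d : ℕ} (U : Matrix (Fin m) (Fin d) ℝ) (i : Fin d) : ℝ :=
  ‖(WithLp.toLp 2 (fun j => U j i) : EuclideanSpace ℝ (Fin m))‖

/-- The objective `∑ ‖uᵢ‖ ^ p * ‖vᵢ‖ ^ p`. -/
def prodObjective {m n d : ℕ} (p : ℝ) (U : Matrix (Fin m) (Fin d) ℝ)
    (V : Matrix (Fin n) (Fin d) ℝ) : ℝ :=
  ∑ i, colNorm U i ^ p * colNorm V i ^ p

/-- The objective `2⁻ᵖ ∑ (‖uᵢ‖ ^ 2 + ‖vᵢ‖ ^ 2) ^ p`. -/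
def sumObjective {m n d : ℕ} (p : ℝ) (U : Matrix (Fin m) (Fin d) ℝ)
    (V : Matrix (Fin n) (Fin d) ℝ) : ℝ :=
  1 / (2 : ℝ) ^ p * ∑ i, (colNorm U i ^ 2 + colNorm V i ^ 2) ^ p

/-- `X = A Σ Bᵀ` is a (thin) singular value decomposition with `d` columns: `A` and `B` have
orthonormal columns and `Σ` is diagonal with nonnegative entries `s`, in any order.
Necessarily `rank X ≤ d ≤ min m n`. -/
structure IsSVD {m n d : ℕ} (X : Matrix (Fin m) (Fin n) ℝ) (A : Matrix (Fin m) (Fin d) ℝ)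
    (s : Fin d → ℝ) (B : Matrix (Fin n) (Fin d) ℝ) : Prop where
  orthonormal_left : A.transpose * A = 1
  orthonormal_right : B.transpose * B = 1
  nonneg : ∀ i, 0 ≤ s i
  eq_mul : X = A * Matrix.diagonal s * B.transpose

end

/-! ### Min-max estimates and tail sums of singular values. -/

section SingularValues

open Module

/-! A factorization writes `X` as a sum of rank-one maps `uᵢ ⊗ vᵢ`. Let `c` be the numbers `‖uᵢ‖
‖vᵢ‖` in descending order. The lower bound is a majorization by tails: for every `k`, the singular
values from index `k` on sum to at most the `c j` with `k ≤ j`. Indeed, restricting `X` to the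
orthogonal complement of the `vᵢ` of the `k` largest terms kills those terms and shifts singular
values by at most `k` places, while a sum of singular values never exceeds the total of the rank-one
norms (`LinearMap.sum_singularValues_add_le_sum_compl`). Since `x ^ p` is concave and increasing,
tail domination passes to sums of `p`-th powers (`sum_rpow_le_sum_rpow_of_tail_le`).

AM-GM carries the bound to the second objective. Splitting an SVD evenly gives `‖uᵢ‖ = ‖vᵢ‖ = √σᵢ`,
which makes every inequality tight. -/

theorem OrthonormalBasis.norm_sq_eq_sum_inner_sq {E ι : Type*} [NormedAddCommGroup E]
    [InnerProductSpace ℝ E] [Fintype ι] (b : OrthonormalBasis ι ℝ E) (x : E) : ‖x‖ ^ 2 = ∑ i, inner ℝ (b i) x ^ 2 := by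
  simpa using (b.sum_sq_norm_inner_right x).symm

theorem LinearMap.finrank_le_finrank_ker_add_card {V ι : Type*} [AddCommGroup V] [Module ℝ V]
    [FiniteDimensional ℝ V] [Fintype ι] (f : V →ₗ[ℝ] (ι → ℝ)) :
    finrank ℝ V ≤ finrank ℝ (LinearMap.ker f) + Fintype.card ι := by
  have h := f.finrank_range_add_finrank_ker
  have h' := Submodule.finrank_le (LinearMap.range f)
  rw [finrank_fintype_fun_eq_card] at h'
  omega

variable {E F : Type*} [NormedAddCommGroup E] [InnerProductSpace ℝ E] [FiniteDimensional ℝ E]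
  [NormedAddCommGroup F] [InnerProductSpace ℝ F] [FiniteDimensional ℝ F]

theorem LinearMap.exists_orthonormalBasis_inner_apply_eq_singularValues (T : E →ₗ[ℝ] F) :
    ∃ b : OrthonormalBasis (Fin (finrank ℝ E)) ℝ E, ∀ i j,
      inner ℝ (T (b i)) (T (b j)) = if i = j then T.singularValues i ^ 2 else 0 := by
  refine ⟨T.isSymmetric_adjoint_comp_self.eigenvectorBasis rfl, fun i j => ?_⟩
  rw [← LinearMap.adjoint_inner_right, ← LinearMap.comp_apply,
    T.isSymmetric_adjoint_comp_self.apply_eigenvectorBasis rfl j, inner_smul_right,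
    OrthonormalBasis.inner_eq_ite, ← T.sq_singularValues_fin rfl j]
  by_cases h : i = j
  · subst h; simp
  · simp [h]

theorem LinearMap.norm_sq_apply_eq_sum_singularValues {T : E →ₗ[ℝ] F}
    {b : OrthonormalBasis (Fin (finrank ℝ E)) ℝ E}
    (hb : ∀ i j, inner ℝ (T (b i)) (T (b j)) = if i = j then T.singularValues i ^ 2 else 0)
    (x : E) : ‖T x‖ ^ 2 = ∑ i : Fin (finrank ℝ E), T.singularValues i ^ 2 * inner ℝ (b i) x ^ 2 := by
  have hx : T x = ∑ i, inner ℝ (b i) x • T (b i) := by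
    conv_lhs => rw [← b.sum_repr' x]
    simp
  rw [← real_inner_self_eq_norm_sq, hx, sum_inner]
  refine Finset.sum_congr rfl fun i _ => ?_
  simp [inner_sum, inner_smul_left, inner_smul_right, hb]
  ring

/-- The lower half of the Courant–Fischer principle. -/
theorem LinearMap.le_singularValues_of_forall_mem (T : E →ₗ[ℝ] F) {j : ℕ} {c : ℝ}
    (V : Submodule ℝ E) (hV : j < finrank ℝ V) (h : ∀ x ∈ V, c * ‖x‖ ≤ ‖T x‖) :
    c ≤ T.singularValues j := by
  obtain ⟨b, hb⟩ := T.exists_orthonormalBasis_inner_apply_eq_singularValues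
  have hjn : j < finrank ℝ E := hV.trans_le V.finrank_le
  let f : V →ₗ[ℝ] (Fin j → ℝ) :=
    LinearMap.pi fun i => (innerₗ E (b (Fin.castLE hjn.le i))) ∘ₗ V.subtype
  -- By dimension, `V` contains a nonzero vector orthogonal to the first `j` singular vectors; on
  -- such vectors `T` stretches by at most `σⱼ`.
  have hf : LinearMap.ker f ≠ ⊥ := LinearMap.ker_ne_bot_of_finrank_lt (by simpa using hV)
  obtain ⟨⟨x, hxV⟩, hx, hx0⟩ := Submodule.exists_mem_ne_zero_of_ne_bot hf
  have hx0' : x ≠ 0 := fun h0 => hx0 (by simp [h0])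
  have hxi : ∀ i : Fin (finrank ℝ E), (i : ℕ) < j → inner ℝ (b i) x = 0 := fun i hi =>
    congrFun (LinearMap.mem_ker.1 hx) ⟨i, hi⟩
  have hσ := T.singularValues_nonneg j
  have key : ‖T x‖ ^ 2 ≤ (T.singularValues j * ‖x‖) ^ 2 := by
    rw [T.norm_sq_apply_eq_sum_singularValues hb, mul_pow, b.norm_sq_eq_sum_inner_sq x,
      Finset.mul_sum]
    refine Finset.sum_le_sum fun i _ => ?_
    rcases lt_or_ge (i : ℕ) j with hi | hi
    · simp [hxi i hi]
    · have := T.singularValues_antitone hi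
      have := T.singularValues_nonneg i
      gcongr
  have h1 : ‖T x‖ ≤ T.singularValues j * ‖x‖ := le_of_sq_le_sq key (by positivity)
  exact le_of_mul_le_mul_right ((h x hxV).trans h1) (norm_pos_iff.2 hx0')

/-- `W` has codimension at most `k`, so it meets the span of the top `k + j + 1` right singular
vectors in dimension at least `j + 1`, and there `T` stretches by at least `σ_{k+j}`. -/
theorem LinearMap.singularValues_add_le_singularValues_domRestrict (T : E →ₗ[ℝ] F)
    (W : Submodule ℝ E) {k : ℕ} (hW : finrank ℝ E ≤ finrank ℝ W + k) (j : ℕ) :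
    T.singularValues (k + j) ≤ (T.domRestrict W).singularValues j := by
  rcases le_or_gt (finrank ℝ E) (k + j) with hj | hj
  · rw [T.singularValues_of_finrank_le hj]
    exact LinearMap.singularValues_nonneg _ _
  obtain ⟨b, hb⟩ := T.exists_orthonormalBasis_inner_apply_eq_singularValues
  let f : W →ₗ[ℝ] (Fin (finrank ℝ E - (k + j + 1)) → ℝ) :=
    LinearMap.pi fun i => (innerₗ E (b ⟨k + j + 1 + i, by omega⟩)) ∘ₗ W.subtype
  have hf := f.finrank_le_finrank_ker_add_card
  rw [Fintype.card_fin] at hf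
  refine LinearMap.le_singularValues_of_forall_mem _ (LinearMap.ker f) (by omega) ?_
  rintro ⟨x, hxW⟩ hx
  have hxi : ∀ i : Fin (finrank ℝ E), k + j < i → inner ℝ (b i) x = 0 := fun i hi => by
    have := congrFun (LinearMap.mem_ker.1 hx) ⟨i - (k + j + 1), by omega⟩
    have hi' : (⟨k + j + 1 + (i - (k + j + 1)), by omega⟩ : Fin (finrank ℝ E)) = i :=
      Fin.ext (by simp; omega)
    simpa [f, hi'] using this
  have hσ := T.singularValues_nonneg (k + j)
  suffices h : (T.singularValues (k + j) * ‖x‖) ^ 2 ≤ ‖T x‖ ^ 2 from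
    le_of_sq_le_sq h (norm_nonneg _)
  rw [T.norm_sq_apply_eq_sum_singularValues hb, mul_pow, b.norm_sq_eq_sum_inner_sq x,
    Finset.mul_sum]
  refine Finset.sum_le_sum fun i _ => ?_
  rcases lt_or_ge (k + j) (i : ℕ) with hi | hi
  · simp [hxi i hi]
  · have := T.singularValues_antitone hi
    gcongr

/-- Triangle inequality for the nuclear norm, by duality: pair `T` with the partial isometry `b j ↦
l j` between its singular vectors. -/
theorem LinearMap.sum_singularValues_le_sum_norm_mul_norm {ι : Type*} (s : Finset ι)
    (T : E →ₗ[ℝ] F) (u : ι → F) (v : ι → E) (hT : ∀ x, T x = ∑ i ∈ s, inner ℝ (v i) x • u i)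
    (M : ℕ) : ∑ j ∈ Finset.range M, T.singularValues j ≤ ∑ i ∈ s, ‖u i‖ * ‖v i‖ := by
  obtain ⟨b, hb⟩ := T.exists_orthonormalBasis_inner_apply_eq_singularValues
  have h1 : ∑ j ∈ Finset.range M, T.singularValues j
      ≤ ∑ j : Fin (finrank ℝ E), T.singularValues j := by
    rw [Fin.sum_univ_eq_sum_range (fun j => T.singularValues j)]
    refine (Finset.sum_le_sum_of_subset_of_nonneg
      (Finset.range_mono (le_max_left M (finrank ℝ E)))
      fun i _ _ => T.singularValues_nonneg i).trans (le_of_eq ?_)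
    refine (Finset.sum_subset (Finset.range_mono (le_max_right M _)) fun i _ hi => ?_).symm
    exact T.singularValues_of_finrank_le (by simpa using hi)
  refine h1.trans ?_
  -- As `0⁻¹ = 0`, the left vector is zero where the singular value is; the nonzero ones are
  -- orthonormal.
  let l : Fin (finrank ℝ E) → F := fun j => (T.singularValues j)⁻¹ • T (b j)
  have hl : ∀ i j, inner ℝ (l i) (l j) =
      if i = j then (if T.singularValues i = 0 then (0 : ℝ) else 1) else 0 := by
    intro i j
    simp only [l, inner_smul_left, inner_smul_right, hb]
    by_cases h : i = j
    · subst h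
      by_cases h0 : T.singularValues i = 0
      · simp [h0]
      · simp [h0]; field_simp
    · simp [h]
  have hσ : ∀ j : Fin (finrank ℝ E), T.singularValues j =
      ∑ i ∈ s, inner ℝ (v i) (b j) * inner ℝ (l j) (u i) := by
    intro j
    have : inner ℝ (l j) (T (b j)) = T.singularValues j := by
      simp only [l, inner_smul_left, hb]
      by_cases h0 : T.singularValues j = 0
      · simp [h0]
      · simp; field_simp
    rw [← this, hT, inner_sum]
    simp [inner_smul_right]
  simp_rw [hσ]
  rw [Finset.sum_comm]
  refine Finset.sum_le_sum fun i _ => ?_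
  have h2 : ∑ j, inner ℝ (v i) (b j) * inner ℝ (l j) (u i)
      = inner ℝ (∑ j, inner ℝ (v i) (b j) • l j) (u i) := by
    simp [sum_inner, inner_smul_left]
  rw [h2, mul_comm]
  refine (real_inner_le_norm _ _).trans ?_
  gcongr
  refine le_of_sq_le_sq ?_ (norm_nonneg _)
  rw [b.norm_sq_eq_sum_inner_sq (v i), ← real_inner_self_eq_norm_sq, sum_inner]
  refine Finset.sum_le_sum fun j _ => ?_
  simp only [inner_sum, inner_smul_left, inner_smul_right, hl]
  rw [real_inner_comm]
  by_cases h0 : T.singularValues j = 0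
  · simp [h0, sq_nonneg]
  · simp [h0, real_inner_comm, sq]

theorem LinearMap.sum_singularValues_add_le_sum_compl {ι : Type*} [Fintype ι] [DecidableEq ι]
    (T : E →ₗ[ℝ] F) (u : ι → F) (v : ι → E) (hT : ∀ x, T x = ∑ i, inner ℝ (v i) x • u i)
    (S : Finset ι) {k : ℕ} (hS : S.card ≤ k) (M : ℕ) :
    ∑ j ∈ Finset.range M, T.singularValues (k + j) ≤ ∑ i ∈ Sᶜ, ‖u i‖ * ‖v i‖ := by
  let f : E →ₗ[ℝ] (S → ℝ) := LinearMap.pi fun i => innerₗ E (v i)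
  have hf := f.finrank_le_finrank_ker_add_card
  rw [Fintype.card_coe] at hf
  set W := LinearMap.ker f
  refine (Finset.sum_le_sum fun j _ =>
    T.singularValues_add_le_singularValues_domRestrict W (k := k) (by omega) j).trans ?_
  -- On `W` only the projection of `vᵢ` matters, and projecting does not increase its norm.
  have h3 := LinearMap.sum_singularValues_le_sum_norm_mul_norm Sᶜ (T.domRestrict W) u
    (fun i => W.orthogonalProjectionOnto (v i)) ?_ M
  · refine h3.trans (Finset.sum_le_sum fun i _ => ?_)
    gcongr
    exact W.norm_orthogonalProjectionOnto_apply_le (v i)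
  · rintro ⟨x, hx⟩
    rw [LinearMap.domRestrict_apply, hT, ← Finset.sum_compl_add_sum S]
    have h0 : ∑ i ∈ S, inner ℝ (v i) x • u i = 0 := Finset.sum_eq_zero fun i hi => by
      have : inner ℝ (v i) x = 0 := congrFun (LinearMap.mem_ker.1 hx) ⟨i, hi⟩
      rw [this, zero_smul]
    rw [h0, add_zero]
    refine Finset.sum_congr rfl fun i _ => ?_
    rw [Submodule.inner_orthogonalProjectionOnto_eq_of_mem_right ⟨x, hx⟩ (v i)]

end SingularValues

/-! ### Tail majorization for the concave power. -/

theorem Real.rpow_le_rpow_add_mul_sub {p x c : ℝ} (hp0 : 0 < p) (hp1 : p ≤ 1) (hx : 0 ≤ x)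
    (hc : 0 < c) : x ^ p ≤ c ^ p + p * c ^ (p - 1) * (x - c) := by
  have h := rpow_one_add_le_one_add_mul_self (s := x / c - 1)
    (by have := div_nonneg hx hc.le; linarith) hp0.le hp1
  rw [add_sub_cancel, Real.div_rpow hx hc.le, div_le_iff₀ (by positivity)] at h
  rw [Real.rpow_sub_one hc.ne']
  refine h.trans (le_of_eq ?_)
  field_simp

/-- The nonpositive extra term, the tangent slope at `c 0` times the total deficit, is kept so that
induction on the head closes. -/
theorem sum_rpow_le_sum_rpow_add_of_tail_le {p : ℝ} (hp0 : 0 < p) (hp1 : p ≤ 1) (N : ℕ)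
    (a c : ℕ → ℝ) (ha : ∀ j, 0 ≤ a j) (hc : ∀ j, 0 ≤ c j) (hanti : Antitone c)
    (h : ∀ k M, k + M = N →
      ∑ j ∈ Finset.range M, a (k + j) ≤ ∑ j ∈ Finset.range M, c (k + j)) :
    ∑ j ∈ Finset.range N, a j ^ p ≤ ∑ j ∈ Finset.range N, c j ^ p +
      p * c 0 ^ (p - 1) * (∑ j ∈ Finset.range N, a j - ∑ j ∈ Finset.range N, c j) := by
  have eq_of_zero : ∀ (M : ℕ) (a c : ℕ → ℝ), (∀ j, 0 ≤ a j) → (∀ j, 0 ≤ c j) → Antitone c →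
      c 0 = 0 → ∑ j ∈ Finset.range M, a j ≤ ∑ j ∈ Finset.range M, c j →
      ∀ j ∈ Finset.range M, a j = c j := by
    intro M a c ha hc hanti h0 hs
    have hz : ∀ j, c j = 0 := fun j => le_antisymm (h0 ▸ hanti (Nat.zero_le j)) (hc j)
    simp only [hz, Finset.sum_const_zero] at hs ⊢
    exact (Finset.sum_eq_zero_iff_of_nonneg fun j _ => ha j).1
      (le_antisymm hs (Finset.sum_nonneg fun j _ => ha j))
  induction N generalizing a c with
  | zero => simp
  | succ N ih =>
    have htot := h 0 (N + 1) (by omega)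
    have htail := h 1 N (by omega)
    simp only [zero_add] at htot
    rcases (hc 0).eq_or_lt with h0 | h0
    · have he := eq_of_zero (N + 1) a c ha hc hanti h0.symm htot
      rw [Finset.sum_congr rfl he,
        Finset.sum_congr rfl (fun j hj => by rw [he j hj] : ∀ j ∈ Finset.range (N + 1),
          a j ^ p = c j ^ p)]
      simp
    have hanti' : Antitone fun j => c (1 + j) := fun i j hij => hanti (by omega)
    have hi := ih (fun j => a (1 + j)) (fun j => c (1 + j)) (fun j => ha _) (fun j => hc _)
      hanti' (fun k M hkM => by
        have := h (1 + k) M (by omega)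
        simpa only [add_assoc] using this)
    -- The slope at `c 1` is at least that at `c 0` and the tail deficit is nonpositive, so the
    -- smaller slope weakens the bound.
    have hg : p * c (1 + 0) ^ (p - 1) * (∑ j ∈ Finset.range N, a (1 + j) -
        ∑ j ∈ Finset.range N, c (1 + j)) ≤ p * c 0 ^ (p - 1) *
        (∑ j ∈ Finset.range N, a (1 + j) - ∑ j ∈ Finset.range N, c (1 + j)) := by
      rcases (hc (1 + 0)).eq_or_lt with h1 | h1
      · have he := eq_of_zero N _ _ (fun j => ha (1 + j)) (fun j => hc (1 + j)) hanti' h1.symm htail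
        rw [Finset.sum_congr rfl he]
        simp
      · refine mul_le_mul_of_nonpos_right ?_ (by linarith)
        gcongr 1
        exact Real.rpow_le_rpow_of_nonpos h1 (hanti (by omega)) (by linarith)
    have hb := Real.rpow_le_rpow_add_mul_sub hp0 hp1 (ha 0) h0
    rw [Finset.sum_range_succ', Finset.sum_range_succ', Finset.sum_range_succ',
      Finset.sum_range_succ']
    simp only [add_comm _ 1] at *
    linarith [hi, hg, hb]

theorem sum_rpow_le_sum_rpow_of_tail_le {p : ℝ} (hp0 : 0 < p) (hp1 : p ≤ 1) (N : ℕ)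
    (a c : ℕ → ℝ) (ha : ∀ j, 0 ≤ a j) (hc : ∀ j, 0 ≤ c j) (hanti : Antitone c)
    (h : ∀ k M, k + M = N →
      ∑ j ∈ Finset.range M, a (k + j) ≤ ∑ j ∈ Finset.range M, c (k + j)) :
    ∑ j ∈ Finset.range N, a j ^ p ≤ ∑ j ∈ Finset.range N, c j ^ p := by
  refine (sum_rpow_le_sum_rpow_add_of_tail_le hp0 hp1 N a c ha hc hanti h).trans ?_
  have h0 := h 0 N (by omega)
  simp only [zero_add] at h0
  have : 0 ≤ p * c 0 ^ (p - 1) := mul_nonneg hp0.le (Real.rpow_nonneg (hc 0) _)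
  nlinarith [mul_nonneg this (sub_nonneg.2 h0)]

/-! ### Schatten bounds, factorizations and SVDs. -/

section Schatten

open Module

theorem exists_perm_antitone {d : ℕ} (c : Fin d → ℝ) :
    ∃ e : Equiv.Perm (Fin d), Antitone (c ∘ e) :=
  ⟨Tuple.sort fun i => -c i, fun _ _ hij =>
    neg_le_neg_iff.1 (Tuple.monotone_sort (fun i => -c i) hij)⟩

section LinearMap

variable {E F : Type*} [NormedAddCommGroup E] [InnerProductSpace ℝ E] [FiniteDimensional ℝ E]
  [NormedAddCommGroup F] [InnerProductSpace ℝ F] [FiniteDimensional ℝ F]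

theorem LinearMap.sum_singularValues_rpow_le {p : ℝ} (hp0 : 0 < p) (hp1 : p ≤ 1) {d : ℕ}
    (T : E →ₗ[ℝ] F) (u : Fin d → F) (v : Fin d → E)
    (hT : ∀ x, T x = ∑ i, inner ℝ (v i) x • u i) (N : ℕ) :
    ∑ j ∈ Finset.range N, T.singularValues j ^ p ≤ ∑ i, (‖u i‖ * ‖v i‖) ^ p := by
  set c : Fin d → ℝ := fun i => ‖u i‖ * ‖v i‖
  have hc0 : ∀ i, 0 ≤ c i := fun i => by positivity
  obtain ⟨e, he⟩ := exists_perm_antitone c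
  let c' : ℕ → ℝ := fun j => if h : j < d then c (e ⟨j, h⟩) else 0
  have hc'0 : ∀ j, 0 ≤ c' j := fun j => by
    simp only [c']; split_ifs
    exacts [hc0 _, le_rfl]
  have hc'fin : ∀ i : Fin d, c' i = c (e i) := fun i => by simp [c']
  have hanti : Antitone c' := by
    intro i j hij
    by_cases hj : j < d
    · have hi : i < d := by omega
      simp only [c', hi, hj, dif_pos]
      exact he (Fin.mk_le_mk.2 hij)
    · simp only [c', hj, dif_neg, not_false_eq_true]
      exact hc'0 i
  -- The length `max N d` covers both the singular values summed and all `d` terms, the latter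
  -- padded with zeros.
  have htail : ∀ k M, k + M = max N d →
      ∑ j ∈ Finset.range M, T.singularValues (k + j) ≤ ∑ j ∈ Finset.range M, c' (k + j) := by
    intro k M hkM
    -- The indices of the `k` largest products.
    let S : Finset (Fin d) := Finset.univ.filter fun i => (e.symm i : ℕ) < k
    have hS : S.card ≤ k := by
      rw [← Finset.card_range k]
      refine Finset.card_le_card_of_injOn (fun i => (e.symm i : ℕ)) ?_ ?_
      · intro i hi
        simpa [S] using hi
      · intro i _ j _ hij
        exact e.symm.injective (Fin.ext hij)
    refine (T.sum_singularValues_add_le_sum_compl u v hT S hS M).trans ?_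
    let g : ℕ → ℝ := fun j => if k ≤ j then c' j else 0
    have hg0 : ∀ j, 0 ≤ g j := fun j => by
      simp only [g]; split_ifs
      exacts [hc'0 _, le_rfl]
    calc ∑ i ∈ Sᶜ, ‖u i‖ * ‖v i‖ = ∑ i, if k ≤ (e.symm i : ℕ) then c i else 0 := by
          rw [← Finset.sum_filter]
          refine Finset.sum_congr ?_ fun _ _ => rfl
          ext i; simp [S]
      _ = ∑ i : Fin d, g i := by
          rw [← Equiv.sum_comp e]
          refine Finset.sum_congr rfl fun i _ => ?_
          simp [g, hc'fin]
      _ = ∑ j ∈ Finset.range d, g j := Fin.sum_univ_eq_sum_range g d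
      _ ≤ ∑ j ∈ Finset.range (k + M), g j :=
          Finset.sum_le_sum_of_subset_of_nonneg
            (Finset.range_mono (hkM ▸ le_max_right N d)) fun j _ _ => hg0 j
      _ = ∑ j ∈ Finset.range M, c' (k + j) := by
          rw [Finset.sum_range_add, Finset.sum_eq_zero, zero_add]
          · exact Finset.sum_congr rfl fun j _ => by simp [g]
          · intro j hj
            simp [g, Finset.mem_range.1 hj]
  calc ∑ j ∈ Finset.range N, T.singularValues j ^ p
      ≤ ∑ j ∈ Finset.range (max N d), T.singularValues j ^ p :=
        Finset.sum_le_sum_of_subset_of_nonneg (Finset.range_mono (le_max_left N d))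
          fun j _ _ => Real.rpow_nonneg (T.singularValues_nonneg j) _
    _ ≤ ∑ j ∈ Finset.range (max N d), c' j ^ p :=
        sum_rpow_le_sum_rpow_of_tail_le hp0 hp1 _ _ _ T.singularValues_nonneg hc'0 hanti htail
    _ = ∑ j ∈ Finset.range d, c' j ^ p := by
        refine (Finset.sum_subset (Finset.range_mono (le_max_right N d)) fun j _ hj => ?_).symm
        rw [Finset.mem_range] at hj
        simp [c', hj, Real.zero_rpow hp0.ne']
    _ = ∑ i, c i ^ p := by
        rw [← Fin.sum_univ_eq_sum_range (fun j => c' j ^ p), ← Equiv.sum_comp e fun i => c i ^ p]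
        exact Finset.sum_congr rfl fun i _ => by rw [hc'fin]

theorem Orthonormal.norm_sq_sum_smul {G ι : Type*} [NormedAddCommGroup G] [InnerProductSpace ℝ G]
    [Fintype ι] {r : ι → G} (hr : Orthonormal ℝ r) (y : ι → ℝ) :
    ‖∑ i, y i • r i‖ ^ 2 = ∑ i, y i ^ 2 := by
  rw [← real_inner_self_eq_norm_sq, hr.inner_sum]
  simp [sq]

/-- On the span of the first `j + 1` vectors of `r`, `T` stretches by at least `s j`, as `s` is
descending; min-max applies. -/
theorem LinearMap.le_singularValues_of_orthonormal {d : ℕ} (T : E →ₗ[ℝ] F) {r : Fin d → E}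
    {l : Fin d → F} (hr : Orthonormal ℝ r) (hl : Orthonormal ℝ l) {s : Fin d → ℝ}
    (hs : ∀ i, 0 ≤ s i) (hanti : Antitone s) (hT : ∀ i, T (r i) = s i • l i) (j : Fin d) :
    s j ≤ T.singularValues j := by
  let ι : Fin (j + 1) → Fin d := Fin.castLE j.isLt
  have hι : Function.Injective ι := Fin.castLE_injective _
  refine T.le_singularValues_of_forall_mem (Submodule.span ℝ (Set.range (r ∘ ι))) ?_ ?_
  · rw [finrank_span_eq_card (hr.comp ι hι).linearIndependent]
    simp
  · intro x hx
    obtain ⟨y, rfl⟩ := (Submodule.mem_span_range_iff_exists_fun ℝ).1 hx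
    have h1 := (hr.comp ι hι).norm_sq_sum_smul y
    have h2 := (hl.comp ι hι).norm_sq_sum_smul fun i => y i * s (ι i)
    have hTx : T (∑ i, y i • (r ∘ ι) i) = ∑ i, (y i * s (ι i)) • (l ∘ ι) i := by
      simp [hT, mul_smul]
    refine le_of_sq_le_sq ?_ (norm_nonneg _)
    rw [hTx, h2, mul_pow, h1, Finset.mul_sum]
    refine Finset.sum_le_sum fun i _ => ?_
    have : s j ≤ s (ι i) := hanti (Fin.le_def.2 (Nat.lt_succ_iff.1 i.isLt))
    have := hs j
    rw [mul_pow, mul_comm]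
    gcongr

theorem LinearMap.sum_rpow_le_sum_singularValues_rpow_of_orthonormal {p : ℝ} (hp0 : 0 < p)
    {d : ℕ} (T : E →ₗ[ℝ] F) {r : Fin d → E} {l : Fin d → F} (hr : Orthonormal ℝ r)
    (hl : Orthonormal ℝ l) {s : Fin d → ℝ} (hs : ∀ i, 0 ≤ s i)
    (hT : ∀ i, T (r i) = s i • l i) :
    ∑ i, s i ^ p ≤ ∑ j ∈ Finset.range d, T.singularValues j ^ p := by
  obtain ⟨e, he⟩ := exists_perm_antitone s
  rw [← Equiv.sum_comp e, ← Fin.sum_univ_eq_sum_range fun j => T.singularValues j ^ p]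
  refine Finset.sum_le_sum fun i _ => ?_
  exact Real.rpow_le_rpow (hs _) (T.le_singularValues_of_orthonormal (hr.comp e e.injective)
    (hl.comp e e.injective) (fun _ => hs _) he (fun _ => hT _) i) hp0.le

/-- A singular value decomposition with the square roots of the singular values distributed
evenly over the left and right vectors. -/
theorem LinearMap.exists_balanced_decomposition (T : E →ₗ[ℝ] F) {d : ℕ}
    (hd : finrank ℝ (LinearMap.range T) ≤ d) :
    ∃ (u : Fin d → F) (v : Fin d → E), (∀ x, T x = ∑ i, inner ℝ (v i) x • u i) ∧
      (∀ i, ‖u i‖ = √(T.singularValues i)) ∧ ∀ i, ‖v i‖ = √(T.singularValues i) := by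
  obtain ⟨b, hb⟩ := T.exists_orthonormalBasis_inner_apply_eq_singularValues
  -- Zero padding, because `d` may exceed the dimension of `E`.
  let w : ℕ → E := fun i => if h : i < finrank ℝ E then b ⟨i, h⟩ else 0
  have hw : ∀ i : Fin (finrank ℝ E), w i = b i := fun i => by simp [w]
  have hTw : ∀ i, ‖T (w i)‖ = T.singularValues i := by
    intro i
    by_cases h : i < finrank ℝ E
    · have h1 := hb ⟨i, h⟩ ⟨i, h⟩
      rw [real_inner_self_eq_norm_sq, if_pos rfl] at h1
      simp only [w, h, dif_pos]
      exact (sq_eq_sq₀ (norm_nonneg _) (T.singularValues_nonneg i)).1 h1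
    · simp [w, h, T.singularValues_of_finrank_le (not_lt.1 h)]
  refine ⟨fun i => (√(T.singularValues i))⁻¹ • T (w i), fun i => √(T.singularValues i) • w i,
    fun x => ?_, fun i => ?_, fun i => ?_⟩
  · let g : ℕ → F := fun i => inner ℝ (w i) x • T (w i)
    have hg : ∀ i, T.singularValues i = 0 → g i = 0 := fun i hi => by
      have : T (w i) = 0 := norm_eq_zero.1 ((hTw i).trans hi)
      simp [g, this]
    have hx : T x = ∑ i ∈ Finset.range (finrank ℝ E), g i := by
      conv_lhs => rw [← b.sum_repr' x]
      rw [← Fin.sum_univ_eq_sum_range]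
      simp [g, hw]
    have hx' : ∑ i ∈ Finset.range (finrank ℝ E), g i = ∑ i ∈ Finset.range d, g i := by
      have hr : finrank ℝ (LinearMap.range T) ≤ finrank ℝ E := LinearMap.finrank_range_le T
      have h0 : ∀ i ∉ Finset.range (finrank ℝ (LinearMap.range T)), g i = 0 := fun i hi =>
        hg i (T.singularValues_eq_zero_iff_le_finrank_range.2 (by simpa using hi))
      rw [← Finset.sum_subset (Finset.range_mono hr) fun i _ hi => h0 i hi,
        ← Finset.sum_subset (Finset.range_mono hd) fun i _ hi => h0 i hi]
    rw [hx, hx', ← Fin.sum_univ_eq_sum_range]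
    refine Finset.sum_congr rfl fun i _ => ?_
    by_cases h : T.singularValues i = 0
    · rw [hg i h]; simp [h]
    · have : √(T.singularValues i) ≠ 0 :=
        (Real.sqrt_pos.2 ((T.singularValues_pos_iff_ne_zero i).2 h)).ne'
      simp only [g, inner_smul_left, smul_smul]
      congr 1
      simp
      field_simp
  · rw [norm_smul, hTw, norm_inv, Real.norm_of_nonneg (Real.sqrt_nonneg _), inv_mul_eq_div,
      Real.div_sqrt]
  · by_cases h : (i : ℕ) < finrank ℝ E
    · simp [w, h, norm_smul, abs_of_nonneg]
    · simp [w, h, T.singularValues_of_finrank_le (not_lt.1 h)]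

end LinearMap

section Matrix

variable {m n d : ℕ}

/-- The `i`-th column of `U` as a vector of the Euclidean space. -/
abbrev colVec (U : Matrix (Fin m) (Fin d) ℝ) (i : Fin d) : EuclideanSpace ℝ (Fin m) :=
  WithLp.toLp 2 fun j => U j i

theorem colNorm_eq_norm_colVec (U : Matrix (Fin m) (Fin d) ℝ) (i : Fin d) :
    colNorm U i = ‖colVec U i‖ := rfl

theorem colNorm_nonneg (U : Matrix (Fin m) (Fin d) ℝ) (i : Fin d) : 0 ≤ colNorm U i :=
  norm_nonneg _

theorem inner_colVec (U V : Matrix (Fin m) (Fin d) ℝ) (i j : Fin d) :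
    inner ℝ (colVec U i) (colVec V j) = (U.transpose * V) i j := by
  simp [PiLp.inner_apply, Matrix.mul_apply, mul_comm]

theorem toEuclideanLin_mul_transpose_apply (U : Matrix (Fin m) (Fin d) ℝ)
    (V : Matrix (Fin n) (Fin d) ℝ) (x : EuclideanSpace ℝ (Fin n)) :
    Matrix.toEuclideanLin (U * V.transpose) x = ∑ i, inner ℝ (colVec V i) x • colVec U i := by
  ext j
  simp only [Matrix.toLpLin_apply, ← Matrix.mulVec_mulVec, Matrix.mulVec, dotProduct,
    Matrix.transpose_apply, WithLp.ofLp_sum, Finset.sum_apply, PiLp.smul_apply, smul_eq_mul,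
    PiLp.inner_apply, RCLike.inner_apply, conj_trivial]
  refine Finset.sum_congr rfl fun i _ => ?_
  rw [mul_comm]
  simp [mul_comm]

theorem orthonormal_colVec {A : Matrix (Fin m) (Fin d) ℝ} (hA : A.transpose * A = 1) :
    Orthonormal ℝ (colVec A) :=
  orthonormal_iff_ite.2 fun i j => by rw [inner_colVec, hA, Matrix.one_apply]

theorem le_of_transpose_mul_self_eq_one {A : Matrix (Fin m) (Fin d) ℝ}
    (hA : A.transpose * A = 1) : d ≤ m := by
  simpa using (orthonormal_colVec hA).linearIndependent.fintype_card_le_finrank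

theorem rank_eq_finrank_range_toEuclideanLin (X : Matrix (Fin m) (Fin n) ℝ) :
    X.rank = finrank ℝ (LinearMap.range (Matrix.toEuclideanLin X)) := by
  rw [Matrix.toEuclideanLin, Matrix.toLpLin_eq_toLin]
  exact X.rank_eq_finrank_range_toLin _ _

theorem schattenPow_eq_sum_range {p : ℝ} (hp0 : 0 < p) (X : Matrix (Fin m) (Fin n) ℝ)
    (hd : X.rank ≤ d) :
    schattenPow p X = ∑ i ∈ Finset.range d, (Matrix.toEuclideanLin X).singularValues i ^ p := by
  have h0 : ∀ i ∉ Finset.range X.rank,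
      (Matrix.toEuclideanLin X).singularValues i ^ p = 0 := fun i hi => by
    rw [(LinearMap.singularValues_eq_zero_iff_le_finrank_range _).2
      (by simpa [rank_eq_finrank_range_toEuclideanLin] using hi),
      Real.zero_rpow hp0.ne']
  have hmn : X.rank ≤ min m n := le_min X.rank_le_height X.rank_le_width
  rw [schattenPow, ← Finset.sum_subset (Finset.range_mono hd) fun i _ hi => h0 i hi,
    ← Finset.sum_subset (Finset.range_mono hmn) fun i _ hi => h0 i hi]

theorem schattenPow_le_prodObjective {p : ℝ} (hp0 : 0 < p) (hp1 : p ≤ 1)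
    (U : Matrix (Fin m) (Fin d) ℝ) (V : Matrix (Fin n) (Fin d) ℝ) :
    schattenPow p (U * V.transpose) ≤ prodObjective p U V := by
  refine (LinearMap.sum_singularValues_rpow_le hp0 hp1 _ (colVec U) (colVec V)
    (toEuclideanLin_mul_transpose_apply U V) _).trans (le_of_eq ?_)
  exact Finset.sum_congr rfl fun i _ => Real.mul_rpow (norm_nonneg _) (norm_nonneg _)

theorem sumObjective_eq_sum {p : ℝ} (U : Matrix (Fin m) (Fin d) ℝ)
    (V : Matrix (Fin n) (Fin d) ℝ) :
    sumObjective p U V = ∑ i, ((colNorm U i ^ 2 + colNorm V i ^ 2) / 2) ^ p := by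
  rw [sumObjective, Finset.mul_sum]
  refine Finset.sum_congr rfl fun i _ => ?_
  rw [Real.div_rpow (by positivity) (by positivity)]
  ring

theorem prodObjective_le_sumObjective {p : ℝ} (hp0 : 0 < p)
    (U : Matrix (Fin m) (Fin d) ℝ) (V : Matrix (Fin n) (Fin d) ℝ) :
    prodObjective p U V ≤ sumObjective p U V := by
  rw [sumObjective_eq_sum]
  refine Finset.sum_le_sum fun i _ => ?_
  have hU := colNorm_nonneg U i
  have hV := colNorm_nonneg V i
  rw [← Real.mul_rpow hU hV]
  exact Real.rpow_le_rpow (by positivity)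
    (by linarith [two_mul_le_add_sq (colNorm U i) (colNorm V i)]) hp0.le

theorem prodObjective_eq_of_colNorm_eq_sqrt {p : ℝ} {U : Matrix (Fin m) (Fin d) ℝ}
    {V : Matrix (Fin n) (Fin d) ℝ} {s : Fin d → ℝ} (hs : ∀ i, 0 ≤ s i)
    (hU : ∀ i, colNorm U i = √(s i)) (hV : ∀ i, colNorm V i = √(s i)) :
    prodObjective p U V = ∑ i, s i ^ p := by
  refine Finset.sum_congr rfl fun i _ => ?_
  rw [hU, hV, ← Real.mul_rpow (Real.sqrt_nonneg _) (Real.sqrt_nonneg _),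
    Real.mul_self_sqrt (hs i)]

theorem sumObjective_eq_of_colNorm_eq_sqrt {p : ℝ} {U : Matrix (Fin m) (Fin d) ℝ}
    {V : Matrix (Fin n) (Fin d) ℝ} {s : Fin d → ℝ} (hs : ∀ i, 0 ≤ s i)
    (hU : ∀ i, colNorm U i = √(s i)) (hV : ∀ i, colNorm V i = √(s i)) :
    sumObjective p U V = ∑ i, s i ^ p := by
  rw [sumObjective_eq_sum]
  refine Finset.sum_congr rfl fun i _ => ?_
  rw [hU, hV, Real.sq_sqrt (hs i), add_self_div_two]

theorem exists_factorization_of_rank_le {p : ℝ} (hp0 : 0 < p) (X : Matrix (Fin m) (Fin n) ℝ)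
    (hd : X.rank ≤ d) : ∃ (U : Matrix (Fin m) (Fin d) ℝ) (V : Matrix (Fin n) (Fin d) ℝ),
      U * V.transpose = X ∧ prodObjective p U V = schattenPow p X ∧
        sumObjective p U V = schattenPow p X := by
  obtain ⟨u, v, hX, hu, hv⟩ :=
    (Matrix.toEuclideanLin X).exists_balanced_decomposition (d := d)
      (rank_eq_finrank_range_toEuclideanLin X ▸ hd)
  refine ⟨Matrix.of fun j i => u i j, Matrix.of fun j i => v i j, ?_, ?_⟩
  · refine Matrix.toEuclideanLin.injective (LinearMap.ext fun x => ?_)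
    rw [toEuclideanLin_mul_transpose_apply, hX]
    rfl
  · have hs : ∀ i : Fin d, 0 ≤ (Matrix.toEuclideanLin X).singularValues i :=
      fun i => LinearMap.singularValues_nonneg _ i
    rw [schattenPow_eq_sum_range hp0 X hd, ← Fin.sum_univ_eq_sum_range
      fun i => (Matrix.toEuclideanLin X).singularValues i ^ p]
    exact ⟨prodObjective_eq_of_colNorm_eq_sqrt hs hu hv,
      sumObjective_eq_of_colNorm_eq_sqrt hs hu hv⟩

theorem colNorm_mul_diagonal_sqrt {A : Matrix (Fin m) (Fin d) ℝ} (hA : A.transpose * A = 1)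
    (s : Fin d → ℝ) (i : Fin d) :
    colNorm (A * Matrix.diagonal fun i => √(s i)) i = √(s i) := by
  have h : colVec (A * Matrix.diagonal fun i => √(s i)) i = √(s i) • colVec A i := by
    ext j
    simp [mul_comm]
  rw [colNorm_eq_norm_colVec, h, norm_smul, (orthonormal_colVec hA).1 i, mul_one,
    Real.norm_of_nonneg (Real.sqrt_nonneg _)]

namespace IsSVD

variable {X : Matrix (Fin m) (Fin n) ℝ} {A : Matrix (Fin m) (Fin d) ℝ} {s : Fin d → ℝ}
  {B : Matrix (Fin n) (Fin d) ℝ}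

theorem mul_sqrt_mul_sqrt_transpose (h : IsSVD X A s B) :
    (A * Matrix.diagonal fun i => √(s i)) * (B * Matrix.diagonal fun i => √(s i)).transpose
      = X := by
  rw [Matrix.transpose_mul, Matrix.diagonal_transpose, ← Matrix.mul_assoc,
    Matrix.mul_assoc A, Matrix.diagonal_mul_diagonal, h.eq_mul]
  simp only [Real.mul_self_sqrt (h.nonneg _)]

theorem toEuclideanLin_apply_colVec (h : IsSVD X A s B) (i : Fin d) :
    Matrix.toEuclideanLin X (colVec B i) = s i • colVec A i := by
  rw [h.eq_mul, toEuclideanLin_mul_transpose_apply]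
  simp only [inner_colVec, h.orthonormal_right, Matrix.one_apply, ite_smul, one_smul, zero_smul,
    Finset.sum_ite_eq', Finset.mem_univ, if_true]
  ext j
  simp [mul_comm]

theorem sum_rpow_eq_schattenPow (h : IsSVD X A s B) {p : ℝ} (hp0 : 0 < p) (hp1 : p ≤ 1) :
    ∑ i, s i ^ p = schattenPow p X := by
  refine le_antisymm ?_ ?_
  · refine ((Matrix.toEuclideanLin X).sum_rpow_le_sum_singularValues_rpow_of_orthonormal hp0
      (orthonormal_colVec h.orthonormal_right) (orthonormal_colVec h.orthonormal_left) h.nonneg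
      h.toEuclideanLin_apply_colVec).trans ?_
    refine Finset.sum_le_sum_of_subset_of_nonneg (Finset.range_mono (le_min
      (le_of_transpose_mul_self_eq_one h.orthonormal_left)
      (le_of_transpose_mul_self_eq_one h.orthonormal_right))) fun i _ _ => ?_
    exact Real.rpow_nonneg (LinearMap.singularValues_nonneg _ i) _
  -- The reverse inequality is the general lower bound applied to the balanced factorization.
  · have := schattenPow_le_prodObjective hp0 hp1 (A * Matrix.diagonal fun i => √(s i))
      (B * Matrix.diagonal fun i => √(s i))
    rwa [h.mul_sqrt_mul_sqrt_transpose, prodObjective_eq_of_colNorm_eq_sqrt h.nonneg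
      (colNorm_mul_diagonal_sqrt h.orthonormal_left s)
      (colNorm_mul_diagonal_sqrt h.orthonormal_right s)] at this

end IsSVD

end Matrix

end Schatten

theorem theorem2 {m n : ℕ} (p : ℝ) (hp0 : 0 < p) (hp1 : p ≤ 1)
    (X : Matrix (Fin m) (Fin n) ℝ) :
    -- the minimum over all numbers of columns `d ≥ 1` and all factorizations
    IsLeast {t : ℝ | ∃ d : ℕ, 1 ≤ d ∧ ∃ (U : Matrix (Fin m) (Fin d) ℝ)
      (V : Matrix (Fin n) (Fin d) ℝ), U * V.transpose = X ∧ prodObjective p U V = t}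
      (schattenPow p X) ∧
    IsLeast {t : ℝ | ∃ d : ℕ, 1 ≤ d ∧ ∃ (U : Matrix (Fin m) (Fin d) ℝ)
      (V : Matrix (Fin n) (Fin d) ℝ), U * V.transpose = X ∧ sumObjective p U V = t}
      (schattenPow p X) ∧
    -- the minimum for any fixed number of columns `d ≥ rank X`
    (∀ d : ℕ, X.rank ≤ d →
      IsLeast {t : ℝ | ∃ (U : Matrix (Fin m) (Fin d) ℝ) (V : Matrix (Fin n) (Fin d) ℝ),
        U * V.transpose = X ∧ prodObjective p U V = t} (schattenPow p X) ∧
      IsLeast {t : ℝ | ∃ (U : Matrix (Fin m) (Fin d) ℝ) (V : Matrix (Fin n) (Fin d) ℝ),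
        U * V.transpose = X ∧ sumObjective p U V = t} (schattenPow p X)) ∧
    -- every singular value decomposition gives a minimizer of both problems
    (∀ (d : ℕ) (A : Matrix (Fin m) (Fin d) ℝ) (s : Fin d → ℝ) (B : Matrix (Fin n) (Fin d) ℝ),
      IsSVD X A s B →
      (A * Matrix.diagonal fun i => √(s i)) * (B * Matrix.diagonal fun i => √(s i)).transpose = X ∧
      prodObjective p (A * Matrix.diagonal fun i => √(s i))
        (B * Matrix.diagonal fun i => √(s i)) = schattenPow p X ∧
      sumObjective p (A * Matrix.diagonal fun i => √(s i))
        (B * Matrix.diagonal fun i => √(s i)) = schattenPow p X) := by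
  have lower_prod : ∀ (d : ℕ) (U : Matrix (Fin m) (Fin d) ℝ) (V : Matrix (Fin n) (Fin d) ℝ),
      U * V.transpose = X → schattenPow p X ≤ prodObjective p U V := by
    rintro d U V rfl
    exact schattenPow_le_prodObjective hp0 hp1 U V
  have lower_sum : ∀ (d : ℕ) (U : Matrix (Fin m) (Fin d) ℝ) (V : Matrix (Fin n) (Fin d) ℝ),
      U * V.transpose = X → schattenPow p X ≤ sumObjective p U V := fun d U V h =>
    (lower_prod d U V h).trans (prodObjective_le_sumObjective hp0 U V)
  refine ⟨⟨?_, ?_⟩, ⟨?_, ?_⟩, fun d hd => ⟨⟨?_, ?_⟩, ⟨?_, ?_⟩⟩, fun d A s B h => ⟨?_, ?_, ?_⟩⟩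
  -- One column more than the rank guarantees `d ≥ 1` even for `X = 0`.
  · obtain ⟨U, V, hX, hprod, -⟩ := exists_factorization_of_rank_le hp0 X (Nat.le_succ X.rank)
    exact ⟨_, Nat.succ_pos _, U, V, hX, hprod⟩
  · rintro t ⟨d, -, U, V, hX, rfl⟩
    exact lower_prod d U V hX
  · obtain ⟨U, V, hX, -, hsum⟩ := exists_factorization_of_rank_le hp0 X (Nat.le_succ X.rank)
    exact ⟨_, Nat.succ_pos _, U, V, hX, hsum⟩
  · rintro t ⟨d, -, U, V, hX, rfl⟩
    exact lower_sum d U V hX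
  · obtain ⟨U, V, hX, hprod, -⟩ := exists_factorization_of_rank_le hp0 X hd
    exact ⟨U, V, hX, hprod⟩
  · rintro t ⟨U, V, hX, rfl⟩
    exact lower_prod d U V hX
  · obtain ⟨U, V, hX, -, hsum⟩ := exists_factorization_of_rank_le hp0 X hd
    exact ⟨U, V, hX, hsum⟩
  · rintro t ⟨U, V, hX, rfl⟩
    exact lower_sum d U V hX
  · exact h.mul_sqrt_mul_sqrt_transpose
  · rw [prodObjective_eq_of_colNorm_eq_sqrt h.nonneg
      (colNorm_mul_diagonal_sqrt h.orthonormal_left s)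
      (colNorm_mul_diagonal_sqrt h.orthonormal_right s), h.sum_rpow_eq_schattenPow hp0 hp1]
  · rw [sumObjective_eq_of_colNorm_eq_sqrt h.nonneg
      (colNorm_mul_diagonal_sqrt h.orthonormal_left s)
      (colNorm_mul_diagonal_sqrt h.orthonormal_right s), h.sum_rpow_eq_schattenPow hp0 hp1]
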